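/- For $\varepsilon>0$ let $p_\varepsilon(z)=\frac{1}{2\pi\varepsilon}e^{-|z|^2/(2\varepsilon)}$, $z\in\mathbb R^2$, be the planar Gaussian kernel. For processes $Z_1,Z_2$ with values in $\mathbb R^2$ and a bounded Borel set $A\subset[0,\infty)^2$, define the approximate mutual intersection local time $$\alpha^\varepsilon_A(Z_1,Z_2)=\int_A p_\varepsilon\big(Z_1(r_1)-Z_2(r_2)\big)\,dr_1\,dr_2 .$$ **Theorem.** Let $t>0$ and $x_1,x_2\in\mathbb R^2$. Suppose that either (a) $Z_1,Z_2$ are independent standard planar Brownian motions started at $x_1$ and $x_2$ respectively; or (b) $Z_1,Z_2$ are independent planar Brownian bridges on $[0,t]$, where $Z_i$ goes from $x_i$ to $x_i$ (that is, $Z_i$ is a Brownian motion started at $x_i$ and conditioned to be at $x_i$ at time $t$: its two coordinates are independent Gaussian processes with continuous paths, with mean $x_i^{(k)}$, $k=1,2$, and covariance $\min(r,s)-rs/t$ for $r,s\in[0,t]$). Then for all Borel sets $A_1,A_2\subset[0,t]$, the random variable $\alpha^\varepsilon_{A_1\times A_2}(Z_1,Z_2)$ is square integrable for every $\varepsilon>0$,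 and there exists a square-integrable random variable $\alpha_{A_1\times A_2}(Z_1,Z_2)$ such that $$\alpha_{A_1\times A_2}(Z_1,Z_2)=\lim_{\varepsilon\to0}\alpha^\varepsilon_{A_1\times A_2}(Z_1,Z_2)$$ in probability, and in fact in $L^2$. -/

import Mathlib

open MeasureTheory ProbabilityTheory Filter Topology
open scoped NNReal ENNReal

noncomputable section

/-- The Euclidean plane `ℝ²`. -/
abbrev Plane : Type := EuclideanSpace ℝ (Fin 2)

/-- The planar Gaussian kernel `p_ε(z) = exp (-|z|² / (2ε)) / (2πε)`, used for `ε > 0`. -/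
def planarHeatKernel (ε : ℝ) (z : Plane) : ℝ :=
  Real.exp (-‖z‖ ^ 2 / (2 * ε)) / (2 * Real.pi * ε)

/-- The approximate mutual intersection local time
`α^ε_A(Z₁, Z₂) = ∫_A p_ε (Z₁(r₁) - Z₂(r₂)) dr` of two processes indexed by `[0, ∞)`, for a bounded
Borel set `A ⊆ [0, ∞)²`, with respect to Lebesgue measure on the plane. (For `r ≥ 0`,
`r.toNNReal` is `r` itself, seen as an element of `[0, ∞)`.) -/
def approxMILT {Ω : Type*} (Z₁ Z₂ : ℝ≥0 → Ω → Plane) (A : Set (ℝ × ℝ)) (ε : ℝ) (ω : Ω) : ℝ :=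
  ∫ r in A, planarHeatKernel ε (Z₁ r.1.toNNReal ω - Z₂ r.2.toNNReal ω)

/-- `Z` is a planar Brownian motion started at `x`: after subtracting `x`, its two coordinates
are independent standard real Brownian motions with almost surely continuous paths. -/
structure IsPlanarBrownianMotion {Ω : Type*} [MeasurableSpace Ω] (x : Plane)
    (Z : ℝ≥0 → Ω → Plane) (P : Measure Ω) : Prop where
  coord : ∀ i : Fin 2, IsBrownianReal (fun r ω ↦ Z r ω i - x i) P
  indep : iIndepFun (fun (i : Fin 2) ω (r : ℝ≥0) ↦ Z r ω i) P

/-- `X` is, on the time interval `[0, t]`, a real Brownian bridge from `a` to `b`, i.e. it has the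
law of a Brownian motion started at `a` and conditioned to be at `b` at time `t`:
the Gaussian process with mean `a + (r / t) (b - a)` and covariance `min r s - r s / t`, with almost
surely continuous paths. Nothing is required of `X` after time `t`. -/
structure IsBrownianBridgeReal {Ω : Type*} [MeasurableSpace Ω] (t : ℝ≥0) (a b : ℝ)
    (X : ℝ≥0 → Ω → ℝ) (P : Measure Ω) : Prop where
  gaussian : IsGaussianProcess (fun (r : Set.Iic t) ↦ X r) P
  mean : ∀ r ≤ t, P[X r] = a + (r : ℝ) / t * (b - a)
  covariance : ∀ r ≤ t, ∀ s ≤ t, cov[X r, X s; P] = min (r : ℝ) s - (r : ℝ) * s / t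
  cont : ∀ᵐ ω ∂P, ContinuousOn (X · ω) (Set.Iic t)

/-- `Z` is, on the time interval `[0, t]`, a planar Brownian bridge from `x` to `y`:
its two coordinates are independent real Brownian bridges. -/
structure IsPlanarBrownianBridge {Ω : Type*} [MeasurableSpace Ω] (t : ℝ≥0) (x y : Plane)
    (Z : ℝ≥0 → Ω → Plane) (P : Measure Ω) : Prop where
  coord : ∀ i : Fin 2, IsBrownianBridgeReal t (x i) (y i) (fun r ω ↦ Z r ω i) P
  indep : iIndepFun (fun (i : Fin 2) ω (r : Set.Iic t) ↦ Z r ω i) P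

end

/-! A family in a Hilbert space is Cauchy as soon as its inner products have a joint limit, so it
suffices that `E[α^ε α^δ]` converges as `ε, δ → 0` independently. By Fubini this second moment is
the integral over time pairs `(r₁, r₂)`, `(s₁, s₂)` of `E[p_ε(X) p_δ(Y)]`, where `X = Z₁(r₁) -
Z₂(r₂)` and `Y = Z₁(s₁) - Z₂(s₂)`. This is the smoothed joint density of `(X, Y)` at the origin.

Fourier inversion writes it as `(2π)⁻⁴` times the integral of the characteristic function of `(X,
Y)` against a Gaussian damping that increases to `1`. Only the modulus of the characteristic
function matters, so the means play no role. It is at most a Gaussian with covariance matrix `Σ₁ +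
Σ₂` in each of the two coordinates. Hence the pointwise limit exists when `det (Σ₁ + Σ₂) > 0`, with
the bound `(2π)⁻² / det (Σ₁ + Σ₂)` uniform in `ε, δ`
(`integral_planarHeatKernel_mul_bound_and_tendsto`).

To integrate this bound over time, `two_mul_sqrt_le_det_add` gives `det (Σ₁ + Σ₂) ≥ 2 √(D₁ D₂)`,
which separates the two processes. It remains that `D ^ (-1/2)` is integrable on `[0, t]²`
(`lintegral_rpow_bridgeDet_lt_top`), where `D = r (s - r) (t - s) / t` for `r ≤ s` is the bridge
determinant. The Brownian determinant `r (s - r)` is larger, so both cases are treated at once.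
Dominated convergence concludes. -/

/-! ### Gaussian integrals and the Cauchy criterion in `L²` -/

theorem gaussian_quadratic_form {a b c : ℝ} (ha : 0 < a) (hd : 0 < a * c - b ^ 2) :
    Integrable (fun p : ℝ × ℝ ↦
      Real.exp (-(a * p.1 ^ 2 + 2 * b * (p.1 * p.2) + c * p.2 ^ 2) / 2)) ∧
    ∫ p : ℝ × ℝ, Real.exp (-(a * p.1 ^ 2 + 2 * b * (p.1 * p.2) + c * p.2 ^ 2) / 2) =
      2 * Real.pi / √(a * c - b ^ 2) := by
  have hc : 0 < (a * c - b ^ 2) / a := div_pos hd ha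
  -- Completing the square in `x` leaves the Schur complement `(a c - b²) / a` as the coefficient of
  -- `y²`.
  have key : ∀ x y : ℝ, Real.exp (-(a * x ^ 2 + 2 * b * (x * y) + c * y ^ 2) / 2) =
      Real.exp (-(a / 2) * (x + b / a * y) ^ 2) *
        Real.exp (-((a * c - b ^ 2) / a / 2) * y ^ 2) := by
    intro x y
    rw [← Real.exp_add]
    congr 1
    field_simp
    ring
  have h1 : ∀ y : ℝ, Integrable fun x : ℝ ↦ Real.exp (-(a / 2) * (x + b / a * y) ^ 2) :=
    fun y ↦ (integrable_exp_neg_mul_sq (half_pos ha)).comp_add_right _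
  have h2 : ∀ y : ℝ, ∫ x : ℝ, Real.exp (-(a / 2) * (x + b / a * y) ^ 2) =
      √(Real.pi / (a / 2)) := fun y ↦ by
    rw [integral_add_right_eq_self (fun x : ℝ ↦ Real.exp (-(a / 2) * x ^ 2)), integral_gaussian]
  have hint : Integrable (fun p : ℝ × ℝ ↦
      Real.exp (-(a * p.1 ^ 2 + 2 * b * (p.1 * p.2) + c * p.2 ^ 2) / 2)) := by
    have hm : AEStronglyMeasurable (fun p : ℝ × ℝ ↦
      Real.exp (-(a * p.1 ^ 2 + 2 * b * (p.1 * p.2) + c * p.2 ^ 2) / 2))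
      (volume : Measure (ℝ × ℝ)) := by fun_prop
    rw [Measure.volume_eq_prod] at hm ⊢
    refine (integrable_prod_iff' hm).2 ⟨Eventually.of_forall fun y ↦ ?_, ?_⟩
    · simp only [key]
      exact (h1 y).mul_const _
    · simp only [Real.norm_eq_abs, Real.abs_exp]
      simp only [key, integral_mul_const, h2]
      exact (integrable_exp_neg_mul_sq (half_pos hc)).const_mul _
  refine ⟨hint, ?_⟩
  rw [Measure.volume_eq_prod] at hint ⊢
  rw [integral_prod_symm _ hint]
  simp only [key, integral_mul_const, h2, integral_const_mul, integral_gaussian]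
  rw [← Real.sqrt_mul (by positivity), eq_div_iff (Real.sqrt_pos.2 hd).ne',
    ← Real.sqrt_mul (by positivity), show Real.pi / (a / 2) * (Real.pi / ((a * c - b ^ 2) / a / 2)) *
      (a * c - b ^ 2) = (2 * Real.pi) ^ 2 by field_simp, Real.sqrt_sq (by positivity)]

/-- Expanding `‖F p.1 - F p.2‖²` gives three inner products; restricting the joint limit to the
diagonal shows that the two squared norms also tend to `L`, so the sum tends to `L - 2L + L = 0`. -/
theorem cauchy_map_of_tendsto_inner {ι E : Type*} [NormedAddCommGroup E] [InnerProductSpace ℝ E]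
    {l : Filter ι} [l.NeBot] {F : ι → E} {L : ℝ}
    (h : Tendsto (fun p : ι × ι ↦ inner ℝ (F p.1) (F p.2)) (l ×ˢ l) (𝓝 L)) :
    Cauchy (map F l) := by
  have h1 : Tendsto (fun p : ι × ι ↦ inner ℝ (F p.1) (F p.1)) (l ×ˢ l) (𝓝 L) :=
    h.comp (tendsto_fst.prodMk tendsto_fst)
  have h2 : Tendsto (fun p : ι × ι ↦ inner ℝ (F p.2) (F p.2)) (l ×ˢ l) (𝓝 L) :=
    h.comp (tendsto_snd.prodMk tendsto_snd)
  have h3 : Tendsto (fun p : ι × ι ↦ ‖F p.1 - F p.2‖ ^ 2) (l ×ˢ l) (𝓝 0) := by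
    convert (h1.sub (h.const_mul 2)).add h2 using 2 with p
    · rw [norm_sub_sq_real, real_inner_self_eq_norm_sq, real_inner_self_eq_norm_sq]
    · ring
  have h4 : Tendsto (fun p : ι × ι ↦ dist (F p.1) (F p.2)) (l ×ˢ l) (𝓝 0) := by
    simpa [dist_eq_norm, Real.sqrt_sq] using h3.sqrt
  rw [cauchy_map_iff, tendsto_uniformity_iff_dist_tendsto_zero]
  exact ⟨‹_›, h4⟩

theorem exists_tendsto_eLpNorm_two_of_tendsto_integral_mul {Ω : Type*} [MeasurableSpace Ω]
    {P : Measure Ω} {A : ℝ → Ω → ℝ} (hA : ∀ ε, 0 < ε → MemLp (A ε) 2 P) {L : ℝ}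
    (h : Tendsto (fun p : ℝ × ℝ ↦ ∫ ω, A p.1 ω * A p.2 ω ∂P) (𝓝[>] 0 ×ˢ 𝓝[>] 0) (𝓝 L)) :
    ∃ α : Ω → ℝ, Measurable α ∧ MemLp α 2 P ∧ TendstoInMeasure P A (𝓝[>] 0) α ∧
      Tendsto (fun ε : ℝ ↦ eLpNorm (A ε - α) 2 P) (𝓝[>] 0) (𝓝 0) := by
  have hpos : ∀ᶠ ε : ℝ in 𝓝[>] 0, 0 < ε := self_mem_nhdsWithin
  -- `toLp` needs membership for every index, so the family is set to `0` off `ε > 0`, which the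
  -- filter does not see.
  let B : ℝ → Ω → ℝ := fun ε ↦ if 0 < ε then A ε else 0
  have hBA : ∀ {ε}, 0 < ε → B ε = A ε := fun {ε} hε ↦ if_pos hε
  have hB : ∀ ε, MemLp (B ε) 2 P := fun ε ↦ by
    by_cases hε : 0 < ε
    · rw [hBA hε]; exact hA ε hε
    · simp only [B, if_neg hε]; exact MemLp.zero
  let F : ℝ → Lp ℝ 2 P := fun ε ↦ (hB ε).toLp (B ε)
  have hF : Cauchy (map F (𝓝[>] 0)) := by
    refine cauchy_map_of_tendsto_inner (L := L) (h.congr' ?_)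
    filter_upwards [hpos.prod_mk hpos] with p hp
    rw [L2.inner_def]
    refine integral_congr_ae ?_
    filter_upwards [(hB p.1).coeFn_toLp, (hB p.2).coeFn_toLp] with ω h1 h2
    simp only [F]
    rw [h1, h2, hBA hp.1, hBA hp.2, RCLike.inner_apply, conj_trivial, mul_comm]
  obtain ⟨G, hG⟩ := cauchy_map_iff_exists_tendsto.1 hF
  have hGm : MemLp (G : Ω → ℝ) 2 P := Lp.memLp G
  have hlim : Tendsto (fun ε : ℝ ↦ eLpNorm (B ε - (G : Ω → ℝ)) 2 P) (𝓝[>] 0) (𝓝 0) := by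
    rw [← Lp.tendsto_Lp_iff_tendsto_eLpNorm'' B hB G hGm, Lp.toLp_coeFn]
    exact hG
  refine ⟨G, (Lp.stronglyMeasurable G).measurable, hGm, ?_, ?_⟩
  · refine (tendstoInMeasure_of_tendsto_eLpNorm two_ne_zero
      (fun ε ↦ (hB ε).1) hGm.1 hlim).congr' ?_ EventuallyEq.rfl
    filter_upwards [hpos] with ε hε
    rw [hBA hε]
  · refine hlim.congr' ?_
    filter_upwards [hpos] with ε hε
    rw [hBA hε]

/-! ### Integrability of the determinant to the power `-1/2` -/

/-- The singular kernel `|x| ^ (-1 / 2)`, with value `∞` at `0`. -/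
noncomputable def invSqrtAbs (x : ℝ) : ℝ≥0∞ := ENNReal.ofReal |x| ^ (-1 / 2 : ℝ)

@[fun_prop]
theorem measurable_invSqrtAbs : Measurable invSqrtAbs := by
  unfold invSqrtAbs; fun_prop

theorem invSqrtAbs_neg (x : ℝ) : invSqrtAbs (-x) = invSqrtAbs x := by
  simp [invSqrtAbs]

theorem invSqrtAbs_sub_comm (x y : ℝ) : invSqrtAbs (x - y) = invSqrtAbs (y - x) := by
  simp [invSqrtAbs, abs_sub_comm]

theorem lintegral_invSqrtAbs_Icc_lt_top : ∫⁻ x in Set.Icc 0 1, invSqrtAbs x < ∞ := by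
  have h : IntegrableOn (fun x : ℝ ↦ x ^ (-1 / 2 : ℝ)) (Set.Ioc 0 1) :=
    (intervalIntegrable_iff_integrableOn_Ioc_of_le zero_le_one).1
      (intervalIntegral.intervalIntegrable_rpow' (by norm_num))
  rw [setLIntegral_congr Ioc_ae_eq_Icc.symm]
  refine lt_of_eq_of_lt (setLIntegral_congr_fun measurableSet_Ioc fun x hx ↦ ?_)
    h.lintegral_lt_top
  simp only [invSqrtAbs]
  rw [abs_of_pos hx.1, ENNReal.ofReal_rpow_of_pos hx.1]

/-- The kernel is at most `1` plus its part near the singularity; the latter is integrated over the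
whole line, where translation invariance makes the bound independent of `a`. -/
theorem exists_lintegral_invSqrtAbs_le (t : ℝ) :
    ∃ M < ∞, ∀ a : ℝ, ∫⁻ x in Set.Icc 0 t, invSqrtAbs (x - a) ≤ M := by
  let g : ℝ → ℝ≥0∞ := (Set.Icc 0 1).indicator invSqrtAbs
  have hg : Measurable g := measurable_invSqrtAbs.indicator measurableSet_Icc
  have hgI : ∫⁻ x, g x < ∞ := by
    rw [lintegral_indicator measurableSet_Icc]; exact lintegral_invSqrtAbs_Icc_lt_top
  refine ⟨volume (Set.Icc 0 t) + ((∫⁻ x, g x) + ∫⁻ x, g x),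
    ENNReal.add_lt_top.2 ⟨by simp, ENNReal.add_lt_top.2 ⟨hgI, hgI⟩⟩, fun a ↦ ?_⟩
  have hle : ∀ x, invSqrtAbs x ≤ 1 + (g x + g (-x)) := by
    intro x
    by_cases hx : x ∈ Set.Icc 0 1
    · have : g x = invSqrtAbs x := Set.indicator_of_mem hx _
      rw [this]
      exact le_add_left le_self_add
    by_cases hx' : -x ∈ Set.Icc 0 1
    · have : g (-x) = invSqrtAbs x := by rw [← invSqrtAbs_neg]; exact Set.indicator_of_mem hx' _
      rw [this]
      exact le_add_left le_add_self
    · refine le_add_right ?_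
      have h1 : 1 ≤ |x| := by
        by_contra! h
        rcases abs_cases x with ⟨h1, h2⟩ | ⟨h1, h2⟩
        · exact hx ⟨h2, by linarith⟩
        · exact hx' ⟨by linarith, by linarith⟩
      exact ENNReal.rpow_le_one_of_one_le_of_neg (by simpa using h1) (by norm_num)
  calc ∫⁻ x in Set.Icc 0 t, invSqrtAbs (x - a)
      ≤ ∫⁻ x in Set.Icc 0 t, (1 + (g (x - a) + g (a - x))) :=
        lintegral_mono fun x ↦ by simpa using hle (x - a)
    _ = volume (Set.Icc 0 t) + ((∫⁻ x in Set.Icc 0 t, g (x - a)) +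
          ∫⁻ x in Set.Icc 0 t, g (a - x)) := by
        rw [lintegral_add_left measurable_const, lintegral_add_left (by fun_prop)]; simp
    _ ≤ volume (Set.Icc 0 t) + ((∫⁻ x, g (x - a)) + ∫⁻ x, g (a - x)) := by
        gcongr <;> exact Measure.restrict_le_self
    _ = _ := by rw [lintegral_sub_right_eq_self, lintegral_sub_left_eq_self]

/-- For `0 ≤ r ≤ s ≤ t` this is `r (s - r) (t - s) / t`, the determinant of the covariance matrix
of `(X r, X s)` for a Brownian bridge `X` on `[0, t]`. -/
noncomputable def bridgeDet (t r s : ℝ) : ℝ := min r s * |r - s| * (t - max r s) / t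

theorem bridgeDet_comm (t r s : ℝ) : bridgeDet t r s = bridgeDet t s r := by
  simp [bridgeDet, min_comm, max_comm, abs_sub_comm]

@[fun_prop]
theorem measurable_bridgeDet (t : ℝ) : Measurable fun p : ℝ × ℝ ↦ bridgeDet t p.1 p.2 := by
  unfold bridgeDet; fun_prop

theorem rpow_mul_third_le {x y z t : ℝ} (hx : 0 ≤ x) (hy : 0 ≤ y) (hz : t / 3 ≤ z) (ht : 0 < t) :
    ENNReal.ofReal (x * y * z / t) ^ (-1 / 2 : ℝ) ≤
      ENNReal.ofReal (1 / 3) ^ (-1 / 2 : ℝ) * (invSqrtAbs x * invSqrtAbs y) := by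
  have h : x * y * (1 / 3) ≤ x * y * z / t := by
    rw [mul_div_assoc]
    refine mul_le_mul_of_nonneg_left ?_ (mul_nonneg hx hy)
    rw [le_div_iff₀ ht]; linarith
  unfold invSqrtAbs
  rw [abs_of_nonneg hx, abs_of_nonneg hy, ← ENNReal.mul_rpow_of_ne_top (by simp) (by simp),
    ← ENNReal.mul_rpow_of_ne_top (by simp) (ENNReal.mul_ne_top (by simp) (by simp)),
    ← ENNReal.ofReal_mul hx, ← ENNReal.ofReal_mul (by norm_num)]
  rw [show (-1 / 2 : ℝ) = -(1 / 2) by norm_num, ENNReal.rpow_neg, ENNReal.rpow_neg]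
  gcongr
  linarith

/-- An integrable majorant of `bridgeDet t r s ^ (-1 / 2)` for `r ≤ s`. -/
noncomputable def bridgeMajorant (t r s : ℝ) : ℝ≥0∞ :=
  invSqrtAbs r * invSqrtAbs (s - r) + invSqrtAbs (s - r) * invSqrtAbs (s - t) +
    invSqrtAbs r * invSqrtAbs (s - t)

/-- The gaps `r`, `s - r`, `t - s` add up to `t`, so one of them is at least `t / 3`. Divided by `t`
it only costs a constant, and two singular factors remain, one product for each case. -/
theorem rpow_bridgeDet_le_of_le {t r s : ℝ} (ht : 0 < t) (hr : 0 ≤ r) (hrs : r ≤ s) (hs : s ≤ t) :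
    ENNReal.ofReal (bridgeDet t r s) ^ (-1 / 2 : ℝ) ≤
      ENNReal.ofReal (1 / 3) ^ (-1 / 2 : ℝ) * bridgeMajorant t r s := by
  have e : bridgeDet t r s = r * (s - r) * (t - s) / t := by
    rw [bridgeDet, min_eq_left hrs, max_eq_right hrs, abs_sub_comm, abs_of_nonneg (by linarith)]
  rw [e, bridgeMajorant, invSqrtAbs_sub_comm s t]
  rcases le_or_gt (t / 3) (t - s) with h | h
  · refine (rpow_mul_third_le hr (sub_nonneg.2 hrs) h ht).trans ?_
    gcongr
    rw [add_assoc]; exact le_self_add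
  rcases le_or_gt (t / 3) r with h' | h'
  · rw [show r * (s - r) * (t - s) / t = (s - r) * (t - s) * r / t by ring]
    refine (rpow_mul_third_le (sub_nonneg.2 hrs) (sub_nonneg.2 hs) h' ht).trans ?_
    gcongr
    rw [add_right_comm]; exact le_add_self
  · rw [show r * (s - r) * (t - s) / t = r * (t - s) * (s - r) / t by ring]
    refine (rpow_mul_third_le hr (sub_nonneg.2 hs) (by linarith) ht).trans ?_
    gcongr
    exact le_add_self

theorem rpow_bridgeDet_le {t r s : ℝ} (ht : 0 < t) (hr : r ∈ Set.Icc 0 t) (hs : s ∈ Set.Icc 0 t) :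
    ENNReal.ofReal (bridgeDet t r s) ^ (-1 / 2 : ℝ) ≤
      ENNReal.ofReal (1 / 3) ^ (-1 / 2 : ℝ) * (bridgeMajorant t r s + bridgeMajorant t s r) := by
  rcases le_total r s with h | h
  · refine (rpow_bridgeDet_le_of_le ht hr.1 h hs.2).trans ?_
    gcongr; exact le_self_add
  · rw [bridgeDet_comm]
    refine (rpow_bridgeDet_le_of_le ht hs.1 h hr.2).trans ?_
    gcongr; exact le_add_self

theorem lintegral_bridgeMajorant_lt_top (t : ℝ) :
    ∫⁻ r in Set.Icc 0 t, ∫⁻ s in Set.Icc 0 t, bridgeMajorant t r s < ∞ := by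
  obtain ⟨M, hM, hle⟩ := exists_lintegral_invSqrtAbs_le t
  have hle0 : ∫⁻ x in Set.Icc 0 t, invSqrtAbs x ≤ M := by simpa using hle 0
  have hle' : ∀ a, ∫⁻ x in Set.Icc 0 t, invSqrtAbs (a - x) ≤ M := fun a ↦ by
    simpa only [invSqrtAbs_sub_comm a] using hle a
  have h1 : ∫⁻ r in Set.Icc 0 t, ∫⁻ s in Set.Icc 0 t, invSqrtAbs r * invSqrtAbs (s - r) ≤
      M * M := by
    calc _ ≤ ∫⁻ r in Set.Icc 0 t, invSqrtAbs r * M := by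
          gcongr with r
          rw [lintegral_const_mul _ (by fun_prop)]
          gcongr; exact hle r
      _ ≤ M * M := by rw [lintegral_mul_const _ (by fun_prop)]; gcongr
  have h2 : ∫⁻ r in Set.Icc 0 t, ∫⁻ s in Set.Icc 0 t, invSqrtAbs (s - r) * invSqrtAbs (s - t) ≤
      M * M := by
    -- Both factors depend on `s`, so here `r` has to be integrated out first.
    rw [lintegral_lintegral_swap (by fun_prop)]
    calc _ ≤ ∫⁻ s in Set.Icc 0 t, M * invSqrtAbs (s - t) := by
          gcongr with s
          rw [lintegral_mul_const _ (by fun_prop)]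
          gcongr; exact hle' s
      _ ≤ M * M := by rw [lintegral_const_mul _ (by fun_prop)]; gcongr; exact hle t
  have h3 : ∫⁻ r in Set.Icc 0 t, ∫⁻ s in Set.Icc 0 t, invSqrtAbs r * invSqrtAbs (s - t) ≤
      M * M := by
    calc _ ≤ ∫⁻ r in Set.Icc 0 t, invSqrtAbs r * M := by
          gcongr with r
          rw [lintegral_const_mul _ (by fun_prop)]
          gcongr; exact hle t
      _ ≤ M * M := by rw [lintegral_mul_const _ (by fun_prop)]; gcongr
  have hMM : M * M < ∞ := ENNReal.mul_lt_top hM hM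
  unfold bridgeMajorant
  have e : ∀ r, ∫⁻ s in Set.Icc 0 t, (invSqrtAbs r * invSqrtAbs (s - r) +
      invSqrtAbs (s - r) * invSqrtAbs (s - t) + invSqrtAbs r * invSqrtAbs (s - t)) =
      (∫⁻ s in Set.Icc 0 t, invSqrtAbs r * invSqrtAbs (s - r)) +
      (∫⁻ s in Set.Icc 0 t, invSqrtAbs (s - r) * invSqrtAbs (s - t)) +
      ∫⁻ s in Set.Icc 0 t, invSqrtAbs r * invSqrtAbs (s - t) := fun r ↦ by
    rw [lintegral_add_left (by fun_prop), lintegral_add_left (by fun_prop)]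
  simp only [e]
  have m1 : Measurable fun r ↦ ∫⁻ s in Set.Icc 0 t, invSqrtAbs r * invSqrtAbs (s - r) :=
    Measurable.lintegral_prod_right' (f := fun p : ℝ × ℝ ↦ invSqrtAbs p.1 * invSqrtAbs (p.2 - p.1))
      (by fun_prop)
  have m3 : Measurable fun r ↦ ∫⁻ s in Set.Icc 0 t, invSqrtAbs r * invSqrtAbs (s - t) :=
    Measurable.lintegral_prod_right' (f := fun p : ℝ × ℝ ↦ invSqrtAbs p.1 * invSqrtAbs (p.2 - t))
      (by fun_prop)
  rw [lintegral_add_right _ m3, lintegral_add_left m1]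
  exact ENNReal.add_lt_top.2 ⟨ENNReal.add_lt_top.2
    ⟨h1.trans_lt hMM, h2.trans_lt hMM⟩, h3.trans_lt hMM⟩

theorem measurable_bridgeMajorant (t : ℝ) :
    Measurable fun p : ℝ × ℝ ↦ bridgeMajorant t p.1 p.2 := by
  have h1 : Measurable fun p : ℝ × ℝ ↦ invSqrtAbs p.1 := by fun_prop
  have h2 : Measurable fun p : ℝ × ℝ ↦ invSqrtAbs (p.2 - p.1) := by fun_prop
  have h3 : Measurable fun p : ℝ × ℝ ↦ invSqrtAbs (p.2 - t) := by fun_prop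
  exact ((h1.mul h2).add (h2.mul h3)).add (h1.mul h3)

theorem lintegral_rpow_bridgeDet_lt_top {t : ℝ} (ht : 0 < t) :
    ∫⁻ r in Set.Icc 0 t, ∫⁻ s in Set.Icc 0 t,
      ENNReal.ofReal (bridgeDet t r s) ^ (-1 / 2 : ℝ) < ∞ := by
  have hm := measurable_bridgeMajorant t
  have hm1 : ∀ r, Measurable fun s ↦ bridgeMajorant t r s := fun r ↦ by
    unfold bridgeMajorant; fun_prop
  have m1 : Measurable fun r ↦ ∫⁻ s in Set.Icc 0 t, bridgeMajorant t r s :=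
    Measurable.lintegral_prod_right' hm
  have hs : ∫⁻ r in Set.Icc 0 t, ∫⁻ s in Set.Icc 0 t, bridgeMajorant t s r =
      ∫⁻ r in Set.Icc 0 t, ∫⁻ s in Set.Icc 0 t, bridgeMajorant t r s :=
    lintegral_lintegral_swap (f := fun r s ↦ bridgeMajorant t s r)
      (hm.comp measurable_swap).aemeasurable
  obtain ⟨C, hCe⟩ : ∃ C, C = ENNReal.ofReal (1 / 3) ^ (-1 / 2 : ℝ) := ⟨_, rfl⟩
  have hC : C ≠ ∞ := by
    rw [hCe]; exact ENNReal.rpow_ne_top_of_ne_zero (by simp) (by simp)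
  have h1 : ∫⁻ r in Set.Icc 0 t, ∫⁻ s in Set.Icc 0 t,
      ENNReal.ofReal (bridgeDet t r s) ^ (-1 / 2 : ℝ) ≤
      ∫⁻ r in Set.Icc 0 t, ∫⁻ s in Set.Icc 0 t,
        C * (bridgeMajorant t r s + bridgeMajorant t s r) :=
    setLIntegral_mono' measurableSet_Icc fun r hr ↦
      setLIntegral_mono' measurableSet_Icc fun s hs ↦ by rw [hCe]; exact rpow_bridgeDet_le ht hr hs
  refine h1.trans_lt ?_
  simp only [lintegral_const_mul' _ _ hC]
  refine ENNReal.mul_lt_top hC.lt_top ?_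
  rw [lintegral_congr fun r ↦ lintegral_add_left (hm1 r) _, lintegral_add_left m1, hs]
  exact ENNReal.add_lt_top.2 ⟨lintegral_bridgeMajorant_lt_top t, lintegral_bridgeMajorant_lt_top t⟩

/-! ### Fourier representation of the smoothed joint density -/

theorem integral_gaussian_fourier {ε : ℝ} (hε : 0 < ε) (x : ℝ) :
    ∫ ξ : ℝ, Complex.exp (Complex.I * (ξ * x : ℝ)) * (Real.exp (-(ε * ξ ^ 2) / 2) : ℝ) =
      (2 * Real.pi / ε : ℂ) ^ (1 / 2 : ℂ) * (Real.exp (-x ^ 2 / (2 * ε)) : ℝ) := by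
  have h := fourierIntegral_gaussian (b := ((ε / 2 : ℝ) : ℂ)) (by simpa using hε) (x : ℂ)
  convert h using 2
  · ext ξ
    push_cast
    congr 2 <;> ring
  · congr 1; push_cast; field_simp
  · push_cast; congr 1; field_simp; norm_num

theorem planarHeatKernel_eq_prod {ε : ℝ} (hε : 0 < ε) (z : Plane) :
    (planarHeatKernel ε z : ℂ) = ((2 * Real.pi) ^ 2 : ℂ)⁻¹ *
      ∏ k, ∫ ξ : ℝ, Complex.exp (Complex.I * (ξ * z k : ℝ)) *
        (Real.exp (-(ε * ξ ^ 2) / 2) : ℝ) := by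
  have hz : ‖z‖ ^ 2 = z 0 ^ 2 + z 1 ^ 2 := by
    rw [EuclideanSpace.norm_sq_eq]; simp
  have hε' : (ε : ℂ) ≠ 0 := by exact_mod_cast hε.ne'
  have hπ : (Real.pi : ℂ) ≠ 0 := by exact_mod_cast Real.pi_ne_zero
  have hsq : (2 * Real.pi / ε : ℂ) ^ (1 / 2 : ℂ) * (2 * Real.pi / ε : ℂ) ^ (1 / 2 : ℂ) =
      2 * Real.pi / ε := by
    rw [← Complex.cpow_add _ _ (div_ne_zero (mul_ne_zero two_ne_zero hπ) hε')]; norm_num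
  simp only [integral_gaussian_fourier hε, Fin.prod_univ_two, planarHeatKernel]
  rw [mul_mul_mul_comm, hsq, ← Complex.ofReal_mul, ← Real.exp_add, hz]
  push_cast
  rw [show (-((z 0 : ℂ) ^ 2 + z 1 ^ 2)) / (2 * ε) = -z 0 ^ 2 / (2 * ε) + -z 1 ^ 2 / (2 * ε) by ring]
  field_simp

/-- The Gaussian damping factor in the Fourier representation of `p_ε(z) p_δ(z')`. -/
noncomputable def fourierDamping (e : ℝ × ℝ) (w : Fin 2 → ℝ × ℝ) : ℝ :=
  ∏ k, Real.exp (-(e.1 * (w k).1 ^ 2 + e.2 * (w k).2 ^ 2) / 2)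

/-- The phase in the Fourier representation of `p_ε(z) p_δ(z')`. -/
noncomputable def fourierPhase (z z' : Plane) (w : Fin 2 → ℝ × ℝ) : ℝ :=
  ∑ k, ((w k).1 * z k + (w k).2 * z' k)

theorem fourierDamping_pos (e : ℝ × ℝ) (w : Fin 2 → ℝ × ℝ) : 0 < fourierDamping e w :=
  Finset.prod_pos fun _ _ ↦ Real.exp_pos _

theorem fourierDamping_le_one {e : ℝ × ℝ} (h1 : 0 ≤ e.1) (h2 : 0 ≤ e.2) (w : Fin 2 → ℝ × ℝ) :
    fourierDamping e w ≤ 1 := by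
  refine Finset.prod_le_one (fun _ _ ↦ (Real.exp_pos _).le) fun k _ ↦ Real.exp_le_one_iff.2 ?_
  have := mul_nonneg h1 (sq_nonneg (w k).1)
  have := mul_nonneg h2 (sq_nonneg (w k).2)
  linarith

@[fun_prop]
theorem continuous_fourierDamping (e : ℝ × ℝ) : Continuous (fourierDamping e) := by
  unfold fourierDamping; fun_prop

theorem integrable_fourierDamping {e : ℝ × ℝ} (h1 : 0 < e.1) (h2 : 0 < e.2) :
    Integrable (fourierDamping e) := by
  have h : Integrable fun p : ℝ × ℝ ↦ Real.exp (-(e.1 * p.1 ^ 2 + e.2 * p.2 ^ 2) / 2) := by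
    simpa using (gaussian_quadratic_form (b := 0) h1 (by simpa using mul_pos h1 h2)).1
  exact Integrable.fintype_prod (f := fun (_ : Fin 2) (p : ℝ × ℝ) ↦
    Real.exp (-(e.1 * p.1 ^ 2 + e.2 * p.2 ^ 2) / 2)) fun _ ↦ h

theorem tendsto_fourierDamping (w : Fin 2 → ℝ × ℝ) :
    Tendsto (fun e ↦ fourierDamping e w) (𝓝[>] 0 ×ˢ 𝓝[>] 0) (𝓝 1) := by
  have hc : Continuous fun e ↦ fourierDamping e w := by unfold fourierDamping; fun_prop
  have h := hc.tendsto ((0 : ℝ), (0 : ℝ))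
  rw [show fourierDamping ((0 : ℝ), (0 : ℝ)) w = 1 by simp [fourierDamping], nhds_prod_eq] at h
  exact h.mono_left (prod_mono nhdsWithin_le_nhds nhdsWithin_le_nhds)

/-- The frequencies are grouped by coordinate: `w k` pairs the frequency of `z k` with that of `z'
k`. Each factor `k` then involves one coordinate of both points, which suits processes with
independent coordinates. -/
theorem planarHeatKernel_mul_eq_integral {e : ℝ × ℝ} (h1 : 0 < e.1) (h2 : 0 < e.2)
    (z z' : Plane) :
    ((planarHeatKernel e.1 z * planarHeatKernel e.2 z' : ℝ) : ℂ) =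
      ((2 * Real.pi) ^ 4 : ℂ)⁻¹ * ∫ w : Fin 2 → ℝ × ℝ,
        Complex.exp (Complex.I * fourierPhase z z' w) * (fourierDamping e w : ℝ) := by
  rw [Complex.ofReal_mul, planarHeatKernel_eq_prod h1, planarHeatKernel_eq_prod h2,
    mul_mul_mul_comm, ← Finset.prod_mul_distrib]
  simp only [← integral_prod_mul, ← Measure.volume_eq_prod]
  congr 1
  · ring
  rw [← integral_fintype_prod_volume_eq_prod (f := fun (k : Fin 2) (p : ℝ × ℝ) ↦
    Complex.exp (Complex.I * (p.1 * z k : ℝ)) * (Real.exp (-(e.1 * p.1 ^ 2) / 2) : ℝ) *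
    (Complex.exp (Complex.I * (p.2 * z' k : ℝ)) * (Real.exp (-(e.2 * p.2 ^ 2) / 2) : ℝ)))]
  congr 1; ext w
  simp only [Fin.prod_univ_two, fourierPhase, fourierDamping, Fin.sum_univ_two, Complex.ofReal_mul,
    Complex.ofReal_exp]
  simp only [← Complex.exp_add]
  congr 1
  push_cast
  ring

theorem norm_planarHeatKernel_le {ε : ℝ} (hε : 0 < ε) (z : Plane) :
    ‖planarHeatKernel ε z‖ ≤ (2 * Real.pi * ε)⁻¹ := by
  unfold planarHeatKernel
  rw [Real.norm_of_nonneg (by positivity), div_eq_mul_inv]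
  refine mul_le_of_le_one_left (by positivity) (Real.exp_le_one_iff.2 ?_)
  rw [neg_div]
  exact neg_nonpos.2 (by positivity)

@[fun_prop]
theorem continuous_planarHeatKernel (ε : ℝ) : Continuous (planarHeatKernel ε) := by
  unfold planarHeatKernel
  fun_prop

theorem aestronglyMeasurable_exp_fourierPhase {Ω : Type*} [MeasurableSpace Ω] {P : Measure Ω}
    [SFinite P] {X Y : Ω → Plane} (hX : AEMeasurable X P)
    (hY : AEMeasurable Y P) : AEStronglyMeasurable
      (fun p : (Fin 2 → ℝ × ℝ) × Ω ↦ Complex.exp (Complex.I * fourierPhase (X p.2) (Y p.2) p.1))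
      (volume.prod P) := by
  have hX' : AEMeasurable (fun p : (Fin 2 → ℝ × ℝ) × Ω ↦ X p.2) (volume.prod P) := hX.comp_snd
  have hY' : AEMeasurable (fun p : (Fin 2 → ℝ × ℝ) × Ω ↦ Y p.2) (volume.prod P) := hY.comp_snd
  have hc : Continuous fun q : (Fin 2 → ℝ × ℝ) × Plane × Plane ↦
      Complex.exp (Complex.I * fourierPhase q.2.1 q.2.2 q.1) := by
    unfold fourierPhase; fun_prop
  exact (hc.measurable.comp_aemeasurable
    (measurable_fst.aemeasurable.prodMk (hX'.prodMk hY'))).aestronglyMeasurable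

theorem integral_planarHeatKernel_mul_eq {Ω : Type*} [MeasurableSpace Ω]
    {P : Measure Ω} [IsProbabilityMeasure P] {X Y : Ω → Plane} (hX : AEMeasurable X P)
    (hY : AEMeasurable Y P) {e : ℝ × ℝ} (h1 : 0 < e.1) (h2 : 0 < e.2) :
    ((∫ ω, planarHeatKernel e.1 (X ω) * planarHeatKernel e.2 (Y ω) ∂P : ℝ) : ℂ) =
      ((2 * Real.pi) ^ 4 : ℂ)⁻¹ * ∫ w : Fin 2 → ℝ × ℝ,
        (∫ ω, Complex.exp (Complex.I * fourierPhase (X ω) (Y ω) w) ∂P) *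
          (fourierDamping e w : ℝ) := by
  rw [← integral_complex_ofReal]
  simp only [planarHeatKernel_mul_eq_integral h1 h2]
  rw [integral_const_mul, integral_integral_swap]
  · simp only [integral_mul_const]
  · have hg : Integrable (fun p : Ω × (Fin 2 → ℝ × ℝ) ↦ fourierDamping e p.2) (P.prod volume) :=
      (integrable_fourierDamping h1 h2).comp_snd P
    refine hg.mono' ?_ (Eventually.of_forall fun p ↦ le_of_eq ?_)
    · have := (aestronglyMeasurable_exp_fourierPhase hX hY).prod_swap
      exact this.mul (Complex.continuous_ofReal.comp_aestronglyMeasurable hg.1)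
    · simp only [Function.uncurry]
      rw [norm_mul, mul_comm Complex.I, Complex.norm_exp_ofReal_mul_I, one_mul, Complex.norm_real,
        Real.norm_of_nonneg (fourierDamping_pos _ _).le]

/-- If the characteristic function of `(X, Y)` is dominated by that of a centred Gaussian vector
whose two coordinate pairs are independent with covariance matrix `!![a, b; b, c]`, then the
smoothed joint density of `(X, Y)` at the origin is bounded and converges. -/
theorem integral_planarHeatKernel_mul_bound_and_tendsto {Ω : Type*} [MeasurableSpace Ω]
    {P : Measure Ω} [IsProbabilityMeasure P] {X Y : Ω → Plane} (hX : AEMeasurable X P)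
    (hY : AEMeasurable Y P) {a b c : ℝ} (ha : 0 < a) (hd : 0 < a * c - b ^ 2)
    (hψ : ∀ w : Fin 2 → ℝ × ℝ, ‖∫ ω, Complex.exp (Complex.I * fourierPhase (X ω) (Y ω) w) ∂P‖ ≤
      ∏ k, Real.exp (-(a * (w k).1 ^ 2 + 2 * b * ((w k).1 * (w k).2) + c * (w k).2 ^ 2) / 2)) :
    (∀ ε δ, 0 < ε → 0 < δ →
      |∫ ω, planarHeatKernel ε (X ω) * planarHeatKernel δ (Y ω) ∂P| ≤
        ((2 * Real.pi) ^ 2)⁻¹ * (a * c - b ^ 2)⁻¹) ∧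
    ∃ L : ℝ, Tendsto (fun e : ℝ × ℝ ↦
      ∫ ω, planarHeatKernel e.1 (X ω) * planarHeatKernel e.2 (Y ω) ∂P)
      (𝓝[>] 0 ×ˢ 𝓝[>] 0) (𝓝 L) := by
  obtain ⟨hQi, hQ⟩ := gaussian_quadratic_form ha hd
  set Q : ℝ × ℝ → ℝ := fun p ↦
    Real.exp (-(a * p.1 ^ 2 + 2 * b * (p.1 * p.2) + c * p.2 ^ 2) / 2) with hQdef
  set ψ : (Fin 2 → ℝ × ℝ) → ℂ := fun w ↦
    ∫ ω, Complex.exp (Complex.I * fourierPhase (X ω) (Y ω) w) ∂P with hψdef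
  have hψm : AEStronglyMeasurable ψ volume :=
    (aestronglyMeasurable_exp_fourierPhase hX hY).integral_prod_right'
  have hBi : Integrable fun w : Fin 2 → ℝ × ℝ ↦ ∏ k, Q (w k) :=
    Integrable.fintype_prod (f := fun (_ : Fin 2) ↦ Q) fun _ ↦ hQi
  -- Each of the two coordinates contributes `det ^ (-1/2)`, whence the power `-1`.
  have hB : ∫ w : Fin 2 → ℝ × ℝ, ∏ k, Q (w k) = (2 * Real.pi) ^ 2 * (a * c - b ^ 2)⁻¹ := by
    rw [integral_fintype_prod_volume_eq_prod (f := fun (_ : Fin 2) ↦ Q)]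
    simp only [Finset.prod_const, Finset.card_univ, Fintype.card_fin]
    rw [hQ, div_pow, Real.sq_sqrt hd.le, div_eq_mul_inv]
  have hle : ∀ e : ℝ × ℝ, 0 < e.1 → 0 < e.2 → ∀ w,
      ‖ψ w * (fourierDamping e w : ℝ)‖ ≤ ∏ k, Q (w k) := fun e h1 h2 w ↦ by
    rw [norm_mul, Complex.norm_real, Real.norm_of_nonneg (fourierDamping_pos _ _).le]
    exact (mul_le_of_le_one_right (norm_nonneg _) (fourierDamping_le_one h1.le h2.le w)).trans
      (hψ w)
  refine ⟨fun ε δ hε hδ ↦ ?_, ?_⟩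
  · have h := integral_planarHeatKernel_mul_eq (e := (ε, δ)) hX hY hε hδ
    have h' := norm_integral_le_of_norm_le hBi (Eventually.of_forall (hle (ε, δ) hε hδ))
    rw [hB] at h'
    rw [← Real.norm_eq_abs, ← Complex.norm_real, h, norm_mul]
    have h4 : ‖((2 * Real.pi) ^ 4 : ℂ)⁻¹‖ = ((2 * Real.pi) ^ 4)⁻¹ := by
      rw [norm_inv, norm_pow, norm_mul, Complex.norm_real, Real.norm_of_nonneg Real.pi_pos.le]
      norm_num
    rw [h4]
    refine (mul_le_mul_of_nonneg_left h' (by positivity)).trans (le_of_eq ?_)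
    have := Real.pi_pos
    field_simp
  · have hpos : ∀ᶠ e : ℝ × ℝ in 𝓝[>] 0 ×ˢ 𝓝[>] 0, 0 < e.1 ∧ 0 < e.2 :=
      Eventually.prod_mk self_mem_nhdsWithin self_mem_nhdsWithin
    have hT : Tendsto (fun e : ℝ × ℝ ↦ ∫ w, ψ w * (fourierDamping e w : ℝ))
        (𝓝[>] 0 ×ˢ 𝓝[>] 0) (𝓝 (∫ w, ψ w)) := by
      refine tendsto_integral_filter_of_dominated_convergence _ ?_ ?_ hBi ?_
      · exact Eventually.of_forall fun e ↦ hψm.mul (by fun_prop)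
      · filter_upwards [hpos] with e he
        exact Eventually.of_forall (hle e he.1 he.2)
      · refine Eventually.of_forall fun w ↦ ?_
        simpa using ((Complex.continuous_ofReal.tendsto 1).comp
          (tendsto_fourierDamping w)).const_mul (ψ w)
    have hT' := (Complex.continuous_re.tendsto _).comp (hT.const_mul ((2 * Real.pi) ^ 4 : ℂ)⁻¹)
    refine ⟨_, hT'.congr' ?_⟩
    filter_upwards [hpos] with e he
    rw [Function.comp_apply, ← integral_planarHeatKernel_mul_eq hX hY he.1 he.2, Complex.ofReal_re]

/-! ### Second moments of time integrals -/

theorem lintegral_prod_prod_mul {α β : Type*} [MeasurableSpace α] [MeasurableSpace β]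
    {μ : Measure α} {ν : Measure β} [SFinite μ] [SFinite ν] {f : α × α → ℝ≥0∞} {g : β × β → ℝ≥0∞}
    (hf : Measurable f) (hg : Measurable g) :
    ∫⁻ p, f (p.1.1, p.2.1) * g (p.1.2, p.2.2) ∂(μ.prod ν).prod (μ.prod ν) =
      (∫⁻ x, ∫⁻ x', f (x, x') ∂μ ∂μ) * ∫⁻ y, ∫⁻ y', g (y, y') ∂ν ∂ν := by
  rw [lintegral_prod _ (by fun_prop)]
  have h : ∀ z : α × β, ∫⁻ z', f (z.1, z'.1) * g (z.2, z'.2) ∂μ.prod ν =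
      (∫⁻ x', f (z.1, x') ∂μ) * ∫⁻ y', g (z.2, y') ∂ν := fun z ↦
    lintegral_prod_mul (f := fun x' ↦ f (z.1, x')) (g := fun y' ↦ g (z.2, y'))
      (by fun_prop) (by fun_prop)
  simp only [h]
  exact lintegral_prod_mul (f := fun x ↦ ∫⁻ x', f (x, x') ∂μ) (g := fun y ↦ ∫⁻ y', g (y, y') ∂ν)
    hf.lintegral_prod_right'.aemeasurable hg.lintegral_prod_right'.aemeasurable

/-- Second moments of the integrals `∫ f ε ω s ∂ν(s)` converge as soon as the correlation functions
`E[f ε · s * f δ · s']` converge and have an integrable majorant. -/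
theorem memLp_and_tendsto_integral_mul {Ω S : Type*} [MeasurableSpace Ω] [MeasurableSpace S]
    {P : Measure Ω} [IsProbabilityMeasure P] {ν : Measure S} [IsFiniteMeasure ν]
    {f : ℝ → Ω → S → ℝ} {C : ℝ → ℝ}
    (hm : ∀ ε, AEStronglyMeasurable (fun q : Ω × S ↦ f ε q.1 q.2) (P.prod ν))
    (hm₁ : ∀ ε, AEStronglyMeasurable (fun q : Ω × S × S ↦ f ε q.1 q.2.1) (P.prod (ν.prod ν)))
    (hm₂ : ∀ ε, AEStronglyMeasurable (fun q : Ω × S × S ↦ f ε q.1 q.2.2) (P.prod (ν.prod ν)))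
    (hC : ∀ ε, 0 < ε → ∀ ω s, ‖f ε ω s‖ ≤ C ε)
    {h : S × S → ℝ≥0∞} (hh : Measurable h) (hfin : ∫⁻ p, h p ∂ν.prod ν < ∞)
    (hle : ∀ᵐ p ∂ν.prod ν, ∀ ε δ, 0 < ε → 0 < δ →
      ENNReal.ofReal |∫ ω, f ε ω p.1 * f δ ω p.2 ∂P| ≤ h p)
    (hlim : ∀ᵐ p ∂ν.prod ν, ∃ L : ℝ, Tendsto (fun e : ℝ × ℝ ↦ ∫ ω, f e.1 ω p.1 * f e.2 ω p.2 ∂P)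
      (𝓝[>] 0 ×ˢ 𝓝[>] 0) (𝓝 L)) :
    (∀ ε, 0 < ε → MemLp (fun ω ↦ ∫ s, f ε ω s ∂ν) 2 P) ∧
    ∃ L : ℝ, Tendsto (fun e : ℝ × ℝ ↦ ∫ ω, (∫ s, f e.1 ω s ∂ν) * (∫ s, f e.2 ω s ∂ν) ∂P)
      (𝓝[>] 0 ×ˢ 𝓝[>] 0) (𝓝 L) := by
  refine ⟨fun ε hε ↦ ?_, ?_⟩
  · refine MemLp.of_bound (hm ε).integral_prod_right' (C ε * ν.real Set.univ)
      (Eventually.of_forall fun ω ↦ ?_)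
    exact norm_integral_le_of_norm_le_const (Eventually.of_forall (hC ε hε ω))
  have hmm : ∀ ε δ, AEStronglyMeasurable (fun q : Ω × S × S ↦ f ε q.1 q.2.1 * f δ q.1 q.2.2)
      (P.prod (ν.prod ν)) := fun ε δ ↦ (hm₁ ε).mul (hm₂ δ)
  have hint : ∀ ε δ, 0 < ε → 0 < δ → Integrable
      (fun q : Ω × S × S ↦ f ε q.1 q.2.1 * f δ q.1 q.2.2) (P.prod (ν.prod ν)) := by
    intro ε δ hε hδ
    refine Integrable.of_bound (hmm ε δ) (C ε * C δ) (Eventually.of_forall fun q ↦ ?_)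
    rw [norm_mul]
    exact mul_le_mul (hC ε hε _ _) (hC δ hδ _ _) (norm_nonneg _)
      ((norm_nonneg _).trans (hC ε hε q.1 q.2.1))
  have hfub : ∀ ε δ, 0 < ε → 0 < δ →
      ∫ p, (∫ ω, f ε ω p.1 * f δ ω p.2 ∂P) ∂ν.prod ν =
        ∫ ω, (∫ s, f ε ω s ∂ν) * (∫ s, f δ ω s ∂ν) ∂P := by
    intro ε δ hε hδ
    rw [← integral_integral_swap (f := fun ω (p : S × S) ↦ f ε ω p.1 * f δ ω p.2) (hint ε δ hε hδ)]
    exact integral_congr_ae (Eventually.of_forall fun ω ↦ integral_prod_mul _ _)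
  have hpos : ∀ᶠ e : ℝ × ℝ in 𝓝[>] 0 ×ˢ 𝓝[>] 0, 0 < e.1 ∧ 0 < e.2 :=
    Eventually.prod_mk self_mem_nhdsWithin self_mem_nhdsWithin
  -- No measurability of this pointwise limit is needed: dominated convergence only asks for that of
  -- the approximations.
  let g : S × S → ℝ := fun p ↦ limUnder (𝓝[>] 0 ×ˢ 𝓝[>] 0)
    fun e : ℝ × ℝ ↦ ∫ ω, f e.1 ω p.1 * f e.2 ω p.2 ∂P
  refine ⟨∫ p, g p ∂ν.prod ν, ?_⟩
  have hT : Tendsto (fun e : ℝ × ℝ ↦ ∫ p, (∫ ω, f e.1 ω p.1 * f e.2 ω p.2 ∂P) ∂ν.prod ν)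
      (𝓝[>] 0 ×ˢ 𝓝[>] 0) (𝓝 (∫ p, g p ∂ν.prod ν)) := by
    refine tendsto_integral_filter_of_dominated_convergence (fun p ↦ (h p).toReal) ?_ ?_ ?_ ?_
    · exact Eventually.of_forall fun e ↦ (hmm e.1 e.2).prod_swap.integral_prod_right'
    · filter_upwards [hpos] with e he
      filter_upwards [hle, ae_lt_top hh hfin.ne] with p hp hp'
      rw [Real.norm_eq_abs]
      exact (ENNReal.ofReal_le_iff_le_toReal hp'.ne).1 (hp _ _ he.1 he.2)
    · exact integrable_toReal_of_lintegral_ne_top hh.aemeasurable hfin.ne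
    · filter_upwards [hlim] with p hp
      exact tendsto_nhds_limUnder hp
  refine hT.congr' ?_
  filter_upwards [hpos] with e he
  exact hfub _ _ he.1 he.2

/-! ### Joint measurability and Gaussian characteristic functions -/

/-- A process with almost surely continuous paths on `[0, t]` is jointly measurable, up to null
sets, even after a measurable time change. -/
theorem aemeasurable_timeChange {Ω S E : Type*} [MeasurableSpace Ω] [MeasurableSpace S]
    [TopologicalSpace E] [TopologicalSpace.PseudoMetrizableSpace E] [MeasurableSpace E]
    [BorelSpace E] {P : Measure Ω} {ρ : Measure S} [SFinite P] [SFinite ρ] {Z : ℝ≥0 → Ω → E}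
    {t : ℝ≥0} (hZ : ∀ r ≤ t, AEMeasurable (Z r) P)
    (hc : ∀ᵐ ω ∂P, ContinuousOn (Z · ω) (Set.Iic t))
    {T : S → ℝ≥0} (hT : Measurable T) (hTt : ∀ᵐ s ∂ρ, T s ≤ t) :
    AEMeasurable (fun q : Ω × S ↦ Z (T q.2) q.1) (P.prod ρ) := by
  -- Times are rounded down to the grid of mesh `1 / (n + 1)` and truncated at `t`, so that the
  -- approximating times stay where paths are continuous. Only countably many times occur, so their
  -- null sets can be united.
  let u : ℕ → ℕ → ℝ≥0 := fun n k ↦ min (k / (n + 1 : ℕ)) t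
  have hu : ∀ n k, AEMeasurable (Z (u n k)) P := fun n k ↦
    hZ _ (min_le_right _ _)
  choose Y hYm hYe using hu
  let N : ℕ → S → ℕ := fun n s ↦ ⌊(T s : ℝ) * (n + 1 : ℕ)⌋₊
  have hN : ∀ n, Measurable (N n) := fun n ↦
    Nat.measurable_floor.comp (hT.coe_nnreal_real.mul_const _)
  let W : ℕ → Ω × S → E := fun n q ↦ Z (u n (N n q.2)) q.1
  have hW : ∀ n, AEMeasurable (W n) (P.prod ρ) := by
    intro n
    refine ⟨fun q ↦ Y n (N n q.2) q.1, ?_, ?_⟩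
    · have h : Measurable fun p : Ω × ℕ ↦ Y n p.2 p.1 :=
        measurable_from_prod_countable_left (hYm n)
      exact h.comp (measurable_fst.prodMk ((hN n).comp measurable_snd))
    · filter_upwards [Measure.quasiMeasurePreserving_fst.ae (ae_all_iff.2 (hYe n))] with q hq
      exact hq _
  refine aemeasurable_of_tendsto_metrizable_ae atTop hW ?_
  filter_upwards [Measure.quasiMeasurePreserving_fst.ae hc,
    Measure.quasiMeasurePreserving_snd.ae hTt] with q hq hq'
  have hlim : Tendsto (fun n : ℕ ↦ (N n q.2 : ℝ≥0) / (n + 1 : ℕ)) atTop (𝓝 (T q.2)) := by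
    rw [← NNReal.tendsto_coe]
    refine (((tendsto_nat_floor_mul_div_atTop (R := ℝ) (T q.2).coe_nonneg).comp
      tendsto_natCast_atTop_atTop).comp (tendsto_add_atTop_nat 1)).congr fun n ↦ ?_
    simp only [N, Function.comp_apply, NNReal.coe_div, NNReal.coe_natCast]
  have hlim' : Tendsto (fun n : ℕ ↦ u n (N n q.2)) atTop (𝓝[Set.Iic t] (T q.2)) := by
    refine tendsto_nhdsWithin_iff.2 ⟨?_, Eventually.of_forall fun n ↦
      (min_le_right _ _ : u n (N n q.2) ≤ t)⟩
    simpa [u, min_eq_left hq'] using hlim.min (tendsto_const_nhds (x := t))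
  exact (hq (T q.2) hq').tendsto.comp hlim'

/-- The shifts `u`, `v` only produce a phase of modulus one. The rest is the characteristic function
at `1` of a real Gaussian variable, whose modulus is determined by its variance. -/
theorem norm_integral_exp_linear_of_hasGaussianLaw {Ω : Type*} [MeasurableSpace Ω] {P : Measure Ω}
    {U V : Ω → ℝ} {u v : ℝ} (h : HasGaussianLaw (fun ω ↦ (U ω - u, V ω - v)) P) (x y : ℝ) :
    ‖∫ ω, Complex.exp (Complex.I * (x * U ω + y * V ω : ℝ)) ∂P‖ =
      Real.exp (-(cov[fun ω ↦ U ω - u, fun ω ↦ U ω - u; P] * x ^ 2 +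
        2 * cov[fun ω ↦ U ω - u, fun ω ↦ V ω - v; P] * (x * y) +
        cov[fun ω ↦ V ω - v, fun ω ↦ V ω - v; P] * y ^ 2) / 2) := by
  have : IsProbabilityMeasure P := h.isProbabilityMeasure
  have hU := h.fst.memLp_two
  have hV := h.snd.memLp_two
  let L : ℝ × ℝ →L[ℝ] ℝ := x • ContinuousLinearMap.fst ℝ ℝ ℝ + y • ContinuousLinearMap.snd ℝ ℝ ℝ
  have hL : HasGaussianLaw (fun ω ↦ x * (U ω - u) + y * (V ω - v)) P := h.map_fun L
  have hvar : Var[fun ω ↦ x * (U ω - u) + y * (V ω - v); P] =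
      cov[fun ω ↦ U ω - u, fun ω ↦ U ω - u; P] * x ^ 2 +
        2 * cov[fun ω ↦ U ω - u, fun ω ↦ V ω - v; P] * (x * y) +
        cov[fun ω ↦ V ω - v, fun ω ↦ V ω - v; P] * y ^ 2 := by
    rw [variance_fun_add (hU.const_mul x) (hV.const_mul y), variance_const_mul, variance_const_mul,
      covariance_const_mul_left, covariance_const_mul_right, covariance_self hU.aemeasurable,
      covariance_self hV.aemeasurable]
    ring
  have hchar := hL.charFun_map_eq 1
  rw [charFun_apply_real, integral_map hL.aemeasurable (by fun_prop)] at hchar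
  have e : ∀ ω, Complex.exp (Complex.I * (x * U ω + y * V ω : ℝ)) =
      Complex.exp (Complex.I * (x * u + y * v : ℝ)) *
        Complex.exp ((1 : ℝ) * (x * (U ω - u) + y * (V ω - v) : ℝ) * Complex.I) := fun ω ↦ by
    rw [← Complex.exp_add]; congr 1; push_cast; ring
  have hi : ∀ a : ℝ, inner ℝ 1 a = a := fun a ↦ by simp
  simp only [hi] at hchar
  simp only [e]
  rw [integral_const_mul, hchar, norm_mul, mul_comm Complex.I, Complex.norm_exp_ofReal_mul_I,
    one_mul, Complex.norm_exp, hvar]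
  congr 1
  simp [-Complex.ofReal_add, -Complex.ofReal_mul, neg_div, -neg_add_rev]

/-- A planar process on `[0, t]`, almost surely continuous, whose two-point characteristic functions
are dominated by those of Gaussian vectors with independent coordinates and with covariance matrix
at least as nondegenerate as that of a Brownian bridge on `[0, t]`. -/
structure IsNondegeneratePlanarProcess {Ω : Type*} [MeasurableSpace Ω] (t : ℝ≥0)
    (Z : ℝ≥0 → Ω → Plane) (P : Measure Ω) : Prop where
  aemeasurable : ∀ r ≤ t, AEMeasurable (Z r) P
  cont : ∀ᵐ ω ∂P, ContinuousOn (Z · ω) (Set.Iic t)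
  charFun_le : ∀ r ≤ t, ∀ s ≤ t, ∃ a b c : ℝ, 0 ≤ a ∧ 0 ≤ c ∧
    bridgeDet t r s ≤ a * c - b ^ 2 ∧ ∀ w : Fin 2 → ℝ × ℝ,
    ‖∫ ω, Complex.exp (Complex.I * fourierPhase (Z r ω) (Z s ω) w) ∂P‖ ≤
      ∏ k, Real.exp (-(a * (w k).1 ^ 2 + 2 * b * ((w k).1 * (w k).2) + c * (w k).2 ^ 2) / 2)

theorem aemeasurable_plane {Ω : Type*} [MeasurableSpace Ω] {P : Measure Ω} {X : Ω → Plane}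
    (h : ∀ k, AEMeasurable (fun ω ↦ X ω k) P) : AEMeasurable X P := by
  have h' : AEMeasurable (fun ω (k : Fin 2) ↦ X ω k) P := aemeasurable_pi_lambda _ h
  exact (WithLp.measurable_toLp 2 (Fin 2 → ℝ)).comp_aemeasurable h'

theorem continuousOn_plane {f : ℝ≥0 → Plane} {s : Set ℝ≥0}
    (h : ∀ k, ContinuousOn (fun r ↦ f r k) s) : ContinuousOn f s := by
  have h' : ContinuousOn (fun r (k : Fin 2) ↦ f r k) s := continuousOn_pi.2 h
  exact (PiLp.continuous_toLp 2 (fun _ : Fin 2 ↦ ℝ)).comp_continuousOn h'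

theorem norm_integral_exp_fourierPhase_of_hasGaussianLaw {Ω : Type*} [MeasurableSpace Ω]
    {P : Measure Ω} {X Y : Ω → Plane} {x : Plane} {a b c : ℝ}
    (hG : ∀ k, HasGaussianLaw (fun ω ↦ (X ω k - x k, Y ω k - x k)) P)
    (hI : IndepFun (fun ω ↦ (X ω 0, Y ω 0)) (fun ω ↦ (X ω 1, Y ω 1)) P)
    (ha : ∀ k, cov[fun ω ↦ X ω k - x k, fun ω ↦ X ω k - x k; P] = a)
    (hb : ∀ k, cov[fun ω ↦ X ω k - x k, fun ω ↦ Y ω k - x k; P] = b)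
    (hc : ∀ k, cov[fun ω ↦ Y ω k - x k, fun ω ↦ Y ω k - x k; P] = c) (w : Fin 2 → ℝ × ℝ) :
    ‖∫ ω, Complex.exp (Complex.I * fourierPhase (X ω) (Y ω) w) ∂P‖ =
      ∏ k, Real.exp (-(a * (w k).1 ^ 2 + 2 * b * ((w k).1 * (w k).2) + c * (w k).2 ^ 2) / 2) := by
  have hX : ∀ k, AEMeasurable (fun ω ↦ X ω k) P := fun k ↦ by
    simpa using (hG k).fst.aemeasurable.add_const (x k)
  have hY : ∀ k, AEMeasurable (fun ω ↦ Y ω k) P := fun k ↦ by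
    simpa using (hG k).snd.aemeasurable.add_const (x k)
  let g : Fin 2 → ℝ × ℝ → ℂ := fun k p ↦
    Complex.exp (Complex.I * ((w k).1 * p.1 + (w k).2 * p.2 : ℝ))
  have hg : ∀ k, Continuous (g k) := fun k ↦ by simp only [g]; fun_prop
  have e : ∀ ω, Complex.exp (Complex.I * fourierPhase (X ω) (Y ω) w) =
      g 0 (X ω 0, Y ω 0) * g 1 (X ω 1, Y ω 1) := fun ω ↦ by
    simp only [g, fourierPhase, Fin.sum_univ_two]
    rw [← Complex.exp_add]; congr 1; push_cast; ring
  simp only [e]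
  rw [hI.integral_fun_comp_mul_comp ((hX 0).prodMk (hY 0)) ((hX 1).prodMk (hY 1))
    (hg 0).aestronglyMeasurable (hg 1).aestronglyMeasurable, norm_mul, Fin.prod_univ_two]
  simp only [g, norm_integral_exp_linear_of_hasGaussianLaw (hG _), ha, hb, hc]

theorem IsPlanarBrownianMotion.isNondegenerate {Ω : Type*} [MeasurableSpace Ω]
    {P : Measure Ω} {x : Plane} {Z : ℝ≥0 → Ω → Plane} (h : IsPlanarBrownianMotion x Z P)
    {t : ℝ≥0} (ht : 0 < t) : IsNondegeneratePlanarProcess t Z P where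
  aemeasurable r _ := aemeasurable_plane fun k ↦ by
    simpa using ((h.coord k).aemeasurable r).add_const (x k)
  cont := by
    filter_upwards [ae_all_iff.2 fun k ↦ (h.coord k).cont] with ω hω
    refine continuousOn_plane fun k ↦ Continuous.continuousOn ?_
    simpa using (hω k).add_const (x k)
  charFun_le r hr s hs := by
    refine ⟨r, min r s, s, r.2, s.2, ?_, fun w ↦ le_of_eq ?_⟩
    -- For `r ≤ s` the covariance determinant is `r (s - r)`, and the bridge determinant has the
    -- extra factor `(t - s) / t ≤ 1`.
    · wlog hrs : r ≤ s generalizing r s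
      · rw [bridgeDet_comm, mul_comm, min_comm]
        exact this s hs r hr (le_of_not_ge hrs)
      have hrs' : (r : ℝ) ≤ s := hrs
      have hst : (s : ℝ) ≤ t := hs
      have ht' : (0 : ℝ) < t := ht
      rw [bridgeDet, min_eq_left hrs', max_eq_right hrs', abs_sub_comm,
        abs_of_nonneg (sub_nonneg.2 hrs'), div_le_iff₀ ht']
      have h1 : (0 : ℝ) ≤ r * (s - r) := mul_nonneg r.2 (sub_nonneg.2 hrs')
      nlinarith [mul_nonneg h1 s.2]
    · refine norm_integral_exp_fourierPhase_of_hasGaussianLaw (x := x)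
        (fun k ↦ (IsPreBrownianReal.isGaussianProcess
          (h.coord k).toIsPreBrownianReal).hasGaussianLaw_prodMk)
        ((h.indep.indepFun zero_ne_one).comp (φ := fun f : ℝ≥0 → ℝ ↦ (f r, f s))
          (ψ := fun f : ℝ≥0 → ℝ ↦ (f r, f s)) (by fun_prop) (by fun_prop))
        (fun k ↦ ?_) (fun k ↦ ?_) (fun k ↦ ?_) w
      · simpa using (h.coord k).covariance_eval r r
      · simpa using (h.coord k).covariance_eval r s
      · simpa using (h.coord k).covariance_eval s s

theorem IsPlanarBrownianBridge.isNondegenerate {Ω : Type*} [MeasurableSpace Ω]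
    {P : Measure Ω} {x y : Plane} {t : ℝ≥0} (ht : 0 < t) {Z : ℝ≥0 → Ω → Plane}
    (h : IsPlanarBrownianBridge t x y Z P) : IsNondegeneratePlanarProcess t Z P where
  aemeasurable r hr := aemeasurable_plane fun k ↦ (h.coord k).gaussian.aemeasurable ⟨r, hr⟩
  cont := by
    filter_upwards [ae_all_iff.2 fun k ↦ (h.coord k).cont] with ω hω
    exact continuousOn_plane hω
  charFun_le r hr s hs := by
    have ht' : (0 : ℝ) < t := ht
    have hnn : ∀ r ≤ t, (0 : ℝ) ≤ min (r : ℝ) r - r * r / t := fun r hr ↦ by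
      have hr' : (r : ℝ) ≤ t := hr
      rw [min_self, sub_nonneg, div_le_iff₀ ht']
      exact mul_le_mul_of_nonneg_left hr' r.2
    refine ⟨min (r : ℝ) r - r * r / t, min (r : ℝ) s - r * s / t, min (s : ℝ) s - s * s / t,
      hnn r hr, hnn s hs, ?_, fun w ↦ le_of_eq ?_⟩
    -- The bridge itself attains `bridgeDet`.
    · refine le_of_eq ?_
      rcases le_total (r : ℝ) s with hrs | hrs
      · rw [bridgeDet, min_eq_left hrs, max_eq_right hrs, abs_sub_comm,
          abs_of_nonneg (sub_nonneg.2 hrs), min_self, min_self]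
        field_simp
        ring
      · rw [bridgeDet, min_eq_right hrs, max_eq_left hrs,
          abs_of_nonneg (sub_nonneg.2 hrs), min_self, min_self]
        field_simp
        ring
    · refine norm_integral_exp_fourierPhase_of_hasGaussianLaw (x := 0) (fun k ↦ ?_)
        ((h.indep.indepFun zero_ne_one).comp
          (φ := fun f : Set.Iic t → ℝ ↦ (f ⟨r, hr⟩, f ⟨s, hs⟩))
          (ψ := fun f : Set.Iic t → ℝ ↦ (f ⟨r, hr⟩, f ⟨s, hs⟩)) (by fun_prop) (by fun_prop))
        (fun k ↦ ?_) (fun k ↦ ?_) (fun k ↦ ?_) w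
      · simpa using (h.coord k).gaussian.hasGaussianLaw_prodMk (s := ⟨r, hr⟩) (t := ⟨s, hs⟩)
      · simpa using (h.coord k).covariance r hr r hr
      · simpa using (h.coord k).covariance r hr s hs
      · simpa using (h.coord k).covariance s hs s hs

/-! ### Combining two independent processes -/

/-- The determinant of the sum is the sum of the determinants plus the mixed term `a₁ c₂ + a₂ c₁ - 2
b₁ b₂`. That term is nonnegative because `bᵢ² ≤ aᵢ cᵢ`, and the arithmetic-geometric mean inequality
turns `d₁ + d₂` into a product, so the time integral factorises. -/
theorem two_mul_sqrt_le_det_add {a₁ b₁ c₁ a₂ b₂ c₂ d₁ d₂ : ℝ} (ha₁ : 0 ≤ a₁) (hc₁ : 0 ≤ c₁)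
    (ha₂ : 0 ≤ a₂) (hc₂ : 0 ≤ c₂) (hd₁ : 0 ≤ d₁) (hd₂ : 0 ≤ d₂) (h₁ : d₁ ≤ a₁ * c₁ - b₁ ^ 2)
    (h₂ : d₂ ≤ a₂ * c₂ - b₂ ^ 2) :
    2 * (√d₁ * √d₂) ≤ (a₁ + a₂) * (c₁ + c₂) - (b₁ + b₂) ^ 2 := by
  have h : 2 * (b₁ * b₂) ≤ a₁ * c₂ + a₂ * c₁ := by
    refine (abs_le_of_sq_le_sq' ?_ (by positivity)).2
    have h3 : b₁ ^ 2 * b₂ ^ 2 ≤ (a₁ * c₁) * (a₂ * c₂) :=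
      mul_le_mul (by linarith) (by linarith) (sq_nonneg _) (by positivity)
    nlinarith [sq_nonneg (a₁ * c₂ - a₂ * c₁)]
  have h4 := two_mul_le_add_sq (√d₁) (√d₂)
  rw [Real.sq_sqrt hd₁, Real.sq_sqrt hd₂] at h4
  nlinarith

theorem fourierPhase_sub (z₁ z₁' z₂ z₂' : Plane) (w : Fin 2 → ℝ × ℝ) :
    fourierPhase (z₁ - z₂) (z₁' - z₂') w = fourierPhase z₁ z₁' w + fourierPhase z₂ z₂' (-w) := by
  simp only [fourierPhase, Fin.sum_univ_two, PiLp.sub_apply, Pi.neg_apply, Prod.fst_neg,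
    Prod.snd_neg]
  ring

theorem integral_planarHeatKernel_mul_le_and_tendsto {Ω : Type*} [MeasurableSpace Ω]
    {P : Measure Ω} [IsProbabilityMeasure P] {t : ℝ≥0} {Z₁ Z₂ : ℝ≥0 → Ω → Plane}
    (h₁ : IsNondegeneratePlanarProcess t Z₁ P)
    (h₂ : IsNondegeneratePlanarProcess t Z₂ P)
    (hI : IndepFun (fun ω (r : Set.Iic t) ↦ Z₁ r ω) (fun ω (r : Set.Iic t) ↦ Z₂ r ω) P)
    {r₁ s₁ r₂ s₂ : ℝ≥0} (hr₁ : r₁ ≤ t) (hs₁ : s₁ ≤ t) (hr₂ : r₂ ≤ t) (hs₂ : s₂ ≤ t)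
    (hd₁ : 0 < bridgeDet t r₁ s₁) (hd₂ : 0 < bridgeDet t r₂ s₂) :
    (∀ ε δ, 0 < ε → 0 < δ → ENNReal.ofReal |∫ ω, planarHeatKernel ε (Z₁ r₁ ω - Z₂ r₂ ω) *
        planarHeatKernel δ (Z₁ s₁ ω - Z₂ s₂ ω) ∂P| ≤
      ENNReal.ofReal (bridgeDet t r₁ s₁) ^ (-1 / 2 : ℝ) *
        ENNReal.ofReal (bridgeDet t r₂ s₂) ^ (-1 / 2 : ℝ)) ∧
    ∃ L : ℝ, Tendsto (fun e : ℝ × ℝ ↦ ∫ ω, planarHeatKernel e.1 (Z₁ r₁ ω - Z₂ r₂ ω) *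
        planarHeatKernel e.2 (Z₁ s₁ ω - Z₂ s₂ ω) ∂P) (𝓝[>] 0 ×ˢ 𝓝[>] 0) (𝓝 L) := by
  obtain ⟨a₁, b₁, c₁, ha₁, hc₁, hD₁, hφ₁⟩ := h₁.charFun_le r₁ hr₁ s₁ hs₁
  obtain ⟨a₂, b₂, c₂, ha₂, hc₂, hD₂, hφ₂⟩ := h₂.charFun_le r₂ hr₂ s₂ hs₂
  have hdet := two_mul_sqrt_le_det_add ha₁ hc₁ ha₂ hc₂ hd₁.le hd₂.le hD₁ hD₂
  have hsq : 0 < √(bridgeDet t r₁ s₁) * √(bridgeDet t r₂ s₂) :=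
    mul_pos (Real.sqrt_pos.2 hd₁) (Real.sqrt_pos.2 hd₂)
  have hdpos : 0 < (a₁ + a₂) * (c₁ + c₂) - (b₁ + b₂) ^ 2 := by linarith
  have ha : 0 < a₁ + a₂ := by
    have : 0 < a₁ := by
      refine ha₁.lt_of_ne fun h ↦ ?_
      rw [← h] at hD₁
      nlinarith [sq_nonneg b₁]
    linarith
  have hψ : ∀ w : Fin 2 → ℝ × ℝ, ‖∫ ω, Complex.exp (Complex.I *
      fourierPhase (Z₁ r₁ ω - Z₂ r₂ ω) (Z₁ s₁ ω - Z₂ s₂ ω) w) ∂P‖ ≤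
      ∏ k, Real.exp (-((a₁ + a₂) * (w k).1 ^ 2 + 2 * (b₁ + b₂) * ((w k).1 * (w k).2) +
        (c₁ + c₂) * (w k).2 ^ 2) / 2) := by
    intro w
    let g : (Fin 2 → ℝ × ℝ) → Plane × Plane → ℂ := fun w p ↦
      Complex.exp (Complex.I * fourierPhase p.1 p.2 w)
    have hg : ∀ w, Continuous (g w) := fun w ↦ by simp only [g, fourierPhase]; fun_prop
    have hI' : IndepFun (fun ω ↦ (Z₁ r₁ ω, Z₁ s₁ ω)) (fun ω ↦ (Z₂ r₂ ω, Z₂ s₂ ω)) P :=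
      hI.comp (φ := fun f : Set.Iic t → Plane ↦ (f ⟨r₁, hr₁⟩, f ⟨s₁, hs₁⟩))
        (ψ := fun f : Set.Iic t → Plane ↦ (f ⟨r₂, hr₂⟩, f ⟨s₂, hs₂⟩))
        (by fun_prop) (by fun_prop)
    have e : ∀ ω, Complex.exp (Complex.I *
        fourierPhase (Z₁ r₁ ω - Z₂ r₂ ω) (Z₁ s₁ ω - Z₂ s₂ ω) w) =
        g w (Z₁ r₁ ω, Z₁ s₁ ω) * g (-w) (Z₂ r₂ ω, Z₂ s₂ ω) := fun ω ↦ by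
      simp only [g]
      rw [fourierPhase_sub, ← Complex.exp_add]; congr 1; push_cast; ring
    simp only [e]
    rw [hI'.integral_fun_comp_mul_comp
      ((h₁.aemeasurable _ hr₁).prodMk (h₁.aemeasurable _ hs₁))
      ((h₂.aemeasurable _ hr₂).prodMk (h₂.aemeasurable _ hs₂))
      (hg w).aestronglyMeasurable (hg (-w)).aestronglyMeasurable, norm_mul]
    -- The quadratic form is even, so the sign of the second frequency is lost and the covariance
    -- matrices add.
    refine (mul_le_mul (hφ₁ w) (hφ₂ (-w)) (norm_nonneg _)
      (Finset.prod_nonneg fun _ _ ↦ (Real.exp_pos _).le)).trans (le_of_eq ?_)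
    rw [← Finset.prod_mul_distrib]
    refine Finset.prod_congr rfl fun k _ ↦ ?_
    rw [← Real.exp_add]
    congr 1
    simp only [Pi.neg_apply, Prod.fst_neg, Prod.snd_neg]
    ring
  obtain ⟨hb, hL⟩ := integral_planarHeatKernel_mul_bound_and_tendsto
    ((h₁.aemeasurable _ hr₁).sub (h₂.aemeasurable _ hr₂))
    ((h₁.aemeasurable _ hs₁).sub (h₂.aemeasurable _ hs₂)) ha hdpos hψ
  refine ⟨fun ε δ hε hδ ↦ ?_, hL⟩
  rw [ENNReal.ofReal_rpow_of_pos hd₁, ENNReal.ofReal_rpow_of_pos hd₂,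
    ← ENNReal.ofReal_mul (by positivity)]
  refine ENNReal.ofReal_le_ofReal ((hb ε δ hε hδ).trans ?_)
  have e : ∀ d : ℝ, 0 < d → d ^ (-1 / 2 : ℝ) = (√d)⁻¹ := fun d hd ↦ by
    rw [Real.sqrt_eq_rpow, ← Real.rpow_neg hd.le]; norm_num
  rw [e _ hd₁, e _ hd₂, ← mul_inv (√_) (√_)]
  have hπ : ((2 * Real.pi) ^ 2)⁻¹ ≤ 1 := inv_le_one_of_one_le₀ (by nlinarith [Real.pi_gt_three])
  refine (mul_le_of_le_one_left (inv_nonneg.2 hdpos.le) hπ).trans ?_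
  exact inv_anti₀ hsq (by linarith)

/-- Existence of the mutual intersection local time of two independent nondegenerate planar
processes. -/
theorem exists_mutualIntersectionLocalTime {Ω : Type*} [MeasurableSpace Ω]
    {P : Measure Ω} [IsProbabilityMeasure P] {t : ℝ≥0} {Z₁ Z₂ : ℝ≥0 → Ω → Plane}
    (ht : 0 < t) (h₁ : IsNondegeneratePlanarProcess t Z₁ P)
    (h₂ : IsNondegeneratePlanarProcess t Z₂ P)
    (hI : IndepFun (fun ω (r : Set.Iic t) ↦ Z₁ r ω) (fun ω (r : Set.Iic t) ↦ Z₂ r ω) P)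
    {A₁ A₂ : Set ℝ} (hA₁ : MeasurableSet A₁) (hA₂ : MeasurableSet A₂)
    (hA₁t : A₁ ⊆ Set.Icc 0 (t : ℝ)) (hA₂t : A₂ ⊆ Set.Icc 0 (t : ℝ)) :
    (∀ ε : ℝ, 0 < ε →
      (∀ᵐ ω ∂P, IntegrableOn (fun r : ℝ × ℝ ↦
        planarHeatKernel ε (Z₁ r.1.toNNReal ω - Z₂ r.2.toNNReal ω)) (A₁ ×ˢ A₂)) ∧
      MemLp (approxMILT Z₁ Z₂ (A₁ ×ˢ A₂) ε) 2 P) ∧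
    ∃ α : Ω → ℝ, Measurable α ∧ MemLp α 2 P ∧
      TendstoInMeasure P (fun ε : ℝ ↦ approxMILT Z₁ Z₂ (A₁ ×ˢ A₂) ε) (𝓝[>] 0) α ∧
      Tendsto (fun ε : ℝ ↦ eLpNorm (approxMILT Z₁ Z₂ (A₁ ×ˢ A₂) ε - α) 2 P) (𝓝[>] 0) (𝓝 0) := by
  set μ₁ : Measure ℝ := volume.restrict A₁ with hμ₁
  set μ₂ : Measure ℝ := volume.restrict A₂ with hμ₂
  have hfin : ∀ A : Set ℝ, A ⊆ Set.Icc 0 (t : ℝ) → IsFiniteMeasure (volume.restrict A) :=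
    fun A hA ↦ ⟨by
      rw [Measure.restrict_apply_univ]
      exact (measure_mono hA).trans_lt measure_Icc_lt_top⟩
  have : IsFiniteMeasure μ₁ := hfin A₁ hA₁t
  have : IsFiniteMeasure μ₂ := hfin A₂ hA₂t
  have hν : (volume : Measure (ℝ × ℝ)).restrict (A₁ ×ˢ A₂) = μ₁.prod μ₂ := by
    rw [Measure.volume_eq_prod, ← Measure.prod_restrict]
  have hmem₁ : ∀ᵐ r ∂μ₁, r ∈ Set.Icc 0 (t : ℝ) :=
    (ae_restrict_mem hA₁).mono fun r hr ↦ hA₁t hr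
  have hmem₂ : ∀ᵐ r ∂μ₂, r ∈ Set.Icc 0 (t : ℝ) :=
    (ae_restrict_mem hA₂).mono fun r hr ↦ hA₂t hr
  have hmem : ∀ᵐ r ∂μ₁.prod μ₂, r.1 ∈ Set.Icc 0 (t : ℝ) ∧ r.2 ∈ Set.Icc 0 (t : ℝ) :=
    (Measure.quasiMeasurePreserving_fst.ae hmem₁).and (Measure.quasiMeasurePreserving_snd.ae hmem₂)
  have hle : ∀ {r : ℝ}, r ∈ Set.Icc 0 (t : ℝ) → r.toNNReal ≤ t := fun hr ↦
    Real.toNNReal_le_iff_le_coe.2 hr.2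
  let f : ℝ → Ω → ℝ × ℝ → ℝ := fun ε ω r ↦
    planarHeatKernel ε (Z₁ r.1.toNNReal ω - Z₂ r.2.toNNReal ω)
  have hmeas : ∀ {S : Type} [MeasurableSpace S] (ρ : Measure S) [SFinite ρ] (T : S → ℝ × ℝ),
      Measurable T → (∀ᵐ s ∂ρ, (T s).1 ∈ Set.Icc 0 (t : ℝ) ∧ (T s).2 ∈ Set.Icc 0 (t : ℝ)) →
      ∀ ε, AEStronglyMeasurable (fun q : Ω × S ↦ f ε q.1 (T q.2)) (P.prod ρ) := by
    intro S _ ρ _ T hT hTt ε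
    have m₁ : AEMeasurable (fun q : Ω × S ↦ Z₁ (T q.2).1.toNNReal q.1) (P.prod ρ) :=
      aemeasurable_timeChange h₁.aemeasurable h₁.cont (T := fun s ↦ (T s).1.toNNReal)
        (by fun_prop) (hTt.mono fun s hs ↦ hle hs.1)
    have m₂ : AEMeasurable (fun q : Ω × S ↦ Z₂ (T q.2).2.toNNReal q.1) (P.prod ρ) :=
      aemeasurable_timeChange h₂.aemeasurable h₂.cont (T := fun s ↦ (T s).2.toNNReal)
        (by fun_prop) (hTt.mono fun s hs ↦ hle hs.2)
    exact ((continuous_planarHeatKernel ε).measurable.comp_aemeasurable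
      (m₁.sub m₂)).aestronglyMeasurable
  have hm := hmeas (μ₁.prod μ₂) id measurable_id hmem
  have hmem_fst := (Measure.quasiMeasurePreserving_fst (μ := μ₁.prod μ₂) (ν := μ₁.prod μ₂)).ae hmem
  have hmem_snd := (Measure.quasiMeasurePreserving_snd (μ := μ₁.prod μ₂) (ν := μ₁.prod μ₂)).ae hmem
  have hC : ∀ ε, 0 < ε → ∀ ω r, ‖f ε ω r‖ ≤ (2 * Real.pi * ε)⁻¹ :=
    fun ε hε ω r ↦ norm_planarHeatKernel_le hε _
  let K : ℝ × ℝ → ℝ≥0∞ := fun p ↦ ENNReal.ofReal (bridgeDet t p.1 p.2) ^ (-1 / 2 : ℝ)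
  have hK : Measurable K := (measurable_bridgeDet t).ennreal_ofReal.pow_const _
  have hKint : ∀ A : Set ℝ, A ⊆ Set.Icc 0 (t : ℝ) →
      ∫⁻ r in A, ∫⁻ s in A, K (r, s) < ∞ := fun A hA ↦ by
    refine lt_of_le_of_lt ?_ (lintegral_rpow_bridgeDet_lt_top (t := (t : ℝ)) ht)
    exact lintegral_mono' (Measure.restrict_mono hA le_rfl) fun r ↦
      lintegral_mono' (Measure.restrict_mono hA le_rfl) le_rfl
  let h : (ℝ × ℝ) × ℝ × ℝ → ℝ≥0∞ := fun p ↦ K (p.1.1, p.2.1) * K (p.1.2, p.2.2)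
  have hh : Measurable h := by fun_prop
  have hhfin : ∫⁻ p, h p ∂(μ₁.prod μ₂).prod (μ₁.prod μ₂) < ∞ := by
    rw [lintegral_prod_prod_mul hK hK]
    exact ENNReal.mul_lt_top (hKint A₁ hA₁t) (hKint A₂ hA₂t)
  -- Since `0 * ∞ = 0`, finiteness of the product `h` forces both factors to be finite only because
  -- neither vanishes.
  have hKne : ∀ p, K p ≠ 0 := fun p h0 ↦ by
    rcases ENNReal.rpow_eq_zero_iff.1 h0 with h0 | h0
    · norm_num at h0
    · exact ENNReal.ofReal_ne_top h0.1
  have hKpos : ∀ p, K p ≠ ∞ → 0 < bridgeDet t p.1 p.2 := fun p hp ↦ by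
    by_contra! hd
    refine hp ?_
    simp only [K]
    rw [ENNReal.ofReal_of_nonpos hd, ENNReal.zero_rpow_of_neg (by norm_num)]
  have hgood : ∀ᵐ p ∂(μ₁.prod μ₂).prod (μ₁.prod μ₂), (∀ ε δ, 0 < ε → 0 < δ →
      ENNReal.ofReal |∫ ω, f ε ω p.1 * f δ ω p.2 ∂P| ≤ h p) ∧
      ∃ L : ℝ, Tendsto (fun e : ℝ × ℝ ↦ ∫ ω, f e.1 ω p.1 * f e.2 ω p.2 ∂P)
        (𝓝[>] 0 ×ˢ 𝓝[>] 0) (𝓝 L) := by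
    -- Almost everywhere `h` is finite; this discards the degenerate time pairs, such as coinciding
    -- or endpoint times, where a determinant is zero.
    filter_upwards [hmem_fst, hmem_snd, ae_lt_top hh hhfin.ne] with p hp hp' hlt
    have hd₁ := hKpos (p.1.1, p.2.1) fun hK' ↦
      hlt.ne (by simp only [h]; rw [hK', ENNReal.top_mul (hKne _)])
    have hd₂ := hKpos (p.1.2, p.2.2) fun hK' ↦
      hlt.ne (by simp only [h]; rw [hK', ENNReal.mul_top (hKne _)])
    have := integral_planarHeatKernel_mul_le_and_tendsto h₁ h₂ hI (hle hp.1) (hle hp'.1)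
      (hle hp.2) (hle hp'.2)
    rw [Real.coe_toNNReal _ hp.1.1, Real.coe_toNNReal _ hp.2.1, Real.coe_toNNReal _ hp'.1.1,
      Real.coe_toNNReal _ hp'.2.1] at this
    exact this hd₁ hd₂
  obtain ⟨hLp, L, hL⟩ := memLp_and_tendsto_integral_mul hm (hmeas _ _ measurable_fst hmem_fst)
    (hmeas _ _ measurable_snd hmem_snd) hC hh hhfin (hgood.mono fun _ hp ↦ hp.1)
    (hgood.mono fun _ hp ↦ hp.2)
  have happrox : ∀ ε, approxMILT Z₁ Z₂ (A₁ ×ˢ A₂) ε = fun ω ↦ ∫ r, f ε ω r ∂μ₁.prod μ₂ :=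
    fun ε ↦ by
      ext ω
      rw [approxMILT, hν]
  refine ⟨fun ε hε ↦ ⟨?_, ?_⟩, ?_⟩
  · have hint : Integrable (fun q : Ω × ℝ × ℝ ↦ f ε q.1 q.2) (P.prod (μ₁.prod μ₂)) :=
      Integrable.of_bound (hm ε) _ (Eventually.of_forall fun q ↦ hC ε hε _ _)
    simp only [IntegrableOn, hν]
    exact hint.prod_right_ae
  · rw [happrox]
    exact hLp ε hε
  · simp only [happrox]
    exact exists_tendsto_eLpNorm_two_of_tendsto_integral_mul hLp hL

theorem theorem5p4 {Ω : Type*} [MeasurableSpace Ω] (P : Measure Ω) [IsProbabilityMeasure P]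
    (t : ℝ≥0) (ht : 0 < t) (x₁ x₂ : Plane) (Z₁ Z₂ : ℝ≥0 → Ω → Plane)
    (hZ :
      -- independent planar Brownian motions started at `x₁` and `x₂`
      (IsPlanarBrownianMotion x₁ Z₁ P ∧ IsPlanarBrownianMotion x₂ Z₂ P ∧
        IndepFun (fun ω (r : ℝ≥0) ↦ Z₁ r ω) (fun ω (r : ℝ≥0) ↦ Z₂ r ω) P) ∨
      -- independent planar Brownian bridges on `[0, t]`, from `x₁` to `x₁` and from `x₂` to `x₂`
      (IsPlanarBrownianBridge t x₁ x₁ Z₁ P ∧ IsPlanarBrownianBridge t x₂ x₂ Z₂ P ∧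
        IndepFun (fun ω (r : Set.Iic t) ↦ Z₁ r ω) (fun ω (r : Set.Iic t) ↦ Z₂ r ω) P))
    (A₁ A₂ : Set ℝ) (hA₁ : MeasurableSet A₁) (hA₂ : MeasurableSet A₂)
    (hA₁t : A₁ ⊆ Set.Icc 0 (t : ℝ)) (hA₂t : A₂ ⊆ Set.Icc 0 (t : ℝ)) :
    -- for every `ε > 0` the approximation is a genuine integral and is square integrable
    (∀ ε : ℝ, 0 < ε →
      (∀ᵐ ω ∂P, IntegrableOn (fun r : ℝ × ℝ ↦
        planarHeatKernel ε (Z₁ r.1.toNNReal ω - Z₂ r.2.toNNReal ω)) (A₁ ×ˢ A₂)) ∧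
      MemLp (approxMILT Z₁ Z₂ (A₁ ×ˢ A₂) ε) 2 P) ∧
    -- it converges, as `ε` decreases to `0`, in probability and in `L²`
    ∃ α : Ω → ℝ, Measurable α ∧ MemLp α 2 P ∧
      TendstoInMeasure P (fun ε : ℝ ↦ approxMILT Z₁ Z₂ (A₁ ×ˢ A₂) ε) (𝓝[>] 0) α ∧
      Tendsto (fun ε : ℝ ↦ eLpNorm (approxMILT Z₁ Z₂ (A₁ ×ˢ A₂) ε - α) 2 P) (𝓝[>] 0) (𝓝 0) := by

  have hI : ∀ {Z₁ Z₂ : ℝ≥0 → Ω → Plane},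
      IndepFun (fun ω (r : ℝ≥0) ↦ Z₁ r ω) (fun ω (r : ℝ≥0) ↦ Z₂ r ω) P →
      IndepFun (fun ω (r : Set.Iic t) ↦ Z₁ r ω) (fun ω (r : Set.Iic t) ↦ Z₂ r ω) P := fun h ↦
    h.comp (φ := fun (f : ℝ≥0 → Plane) (r : Set.Iic t) ↦ f r)
      (ψ := fun (f : ℝ≥0 → Plane) (r : Set.Iic t) ↦ f r) (by fun_prop) (by fun_prop)
  rcases hZ with ⟨h₁, h₂, h⟩ | ⟨h₁, h₂, h⟩
  · exact exists_mutualIntersectionLocalTime ht (h₁.isNondegenerate ht)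
      (h₂.isNondegenerate ht) (hI h) hA₁ hA₂ hA₁t hA₂t
  · exact exists_mutualIntersectionLocalTime ht (h₁.isNondegenerate ht)
      (h₂.isNondegenerate ht) h hA₁ hA₂ hA₁t hA₂t
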